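/- Let $R$ be a ring or, more generally, a small preadditive category, and let $R\text{-Mod}$ be the category of left $R$-modules (additive functors $R\to\mathbf{Ab}$). A full subcategory of $R\text{-Mod}$, closed under isomorphisms, is *definable* if it is closed under direct products, direct limits and pure submodules. Let $\mathrm{Ab}(R)=(R\text{-mod},\mathbf{Ab})^{\mathrm{fp}}$ be the category of finitely presented additive functors on finitely presented $R$-modules, each functor being extended to $R\text{-Mod}$ so as to commute with direct limits. For a definable subcategory $\mathcal D$ let $\mathcal S_{\mathcal D}$ be the Serre subcategory of those $F\in\mathrm{Ab}(R)$ with $F(D)=0$ for all $D\in\mathcal D$, and let $\mathcal A(\mathcal D)=\mathrm{Ab}(R)/\mathcal S_{\mathcal D}$ be the quotient abelian category (the functor category of $\mathcal D$, or category of pp-pairs for $\mathcal D$). Let $N_1,\dots,N_t$ be finitely many finitely presented $R$-modules, and let $\mathcal D$ be a definable subcategory of $R\text{-Mod}$ whose objects are exactly the (arbitrary, possibly infinite) direct sums of copies of $N_1,\dots,N_t$. Put $M=\bigoplus_{i=1}^t N_i$ and $S=\mathrm{End}_R(M)$, acting on the left of $M$. Then there is an equivalence between $\mathcal A(\mathcal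 D)$ and the category $S\text{-mod}$ of finitely presented left $S$-modules, induced by $F\mapsto F(M)$. Under it, a finitely presented $S$-module $A$ corresponds to the functor $F_A$ on $\mathcal D$ that commutes with direct limits and is given on the finitely presented modules $D\in\mathcal D$ (that is, on the finite direct sums of copies of the $N_i$) by $$F_A(D)\;\cong\;\mathrm{Hom}_S(\mathrm{Hom}_R(D,M),A),$$ naturally in $D$. More precisely, every $F\in\mathrm{Ab}(R)$ whose image in $\mathcal A(\mathcal D)$ corresponds to $A$ (there is one for each $A$) commutes with direct limits, and there is a natural transformation $F(D)\to\mathrm{Hom}_S(\mathrm{Hom}_R(D,M),A)$ of functors of $D\in\mathcal D$ which is an isomorphism whenever $D$ is finitely presented. -/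

import Mathlib

universe u

open CategoryTheory CategoryTheory.Limits Opposite

/-- The category `R-Mod` of left modules over a small preadditive category `R` (a ring with many
objects; a ring is the case of one object): additive functors from `R` to abelian groups. -/
abbrev LMod (R : Type u) [SmallCategory R] [Preadditive R] : Type (u + 1) :=
  R ⥤+ AddCommGrpCat.{u}

/-! ### Pp formulas, purity and definable subcategories -/

/-- A pp formula `∃ y, G (x, y) = 0` for (multisorted) left `R`-modules. The free variables `x` have
sorts `xSort`, the bound variables `y` have sorts `ySort`, and the `j`-th equation is
`∑ i, a i j x_i + ∑ k, b k j y_k = 0`, in sort `eqSort j`. -/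
structure PPFormula (R : Type u) [SmallCategory R] [Preadditive R] where
  numX : ℕ
  numY : ℕ
  numEq : ℕ
  xSort : Fin numX → R
  ySort : Fin numY → R
  eqSort : Fin numEq → R
  a : ∀ i j, xSort i ⟶ eqSort j
  b : ∀ k j, ySort k ⟶ eqSort j

/-- The solution set `φ(M)` of a pp formula in a module `M`. -/
def PPFormula.solutions {R : Type u} [SmallCategory R] [Preadditive R] (φ : PPFormula R)
    (M : LMod R) : Set (∀ i, M.obj.obj (φ.xSort i)) :=
  {x | ∃ y : ∀ k, M.obj.obj (φ.ySort k), ∀ j,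
    ∑ i, M.obj.map (φ.a i j) (x i) + ∑ k, M.obj.map (φ.b k j) (y k) = 0}

/-- `f : A ⟶ B` is a pure embedding: it is injective and `φ(A) = Aⁿ ∩ φ(B)` for every pp formula
`φ` (where `A` is identified with its image in `B`). -/
def IsPureEmbedding {R : Type u} [SmallCategory R] [Preadditive R] {A B : LMod R} (f : A ⟶ B) :
    Prop :=
  (∀ r : R, Function.Injective (f.hom.app r)) ∧
  ∀ (φ : PPFormula R) (x : ∀ i, A.obj.obj (φ.xSort i)),
    x ∈ φ.solutions A ↔ (fun i => f.hom.app (φ.xSort i) (x i)) ∈ φ.solutions B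

/-- A definable subcategory of `R-Mod`: a full subcategory closed under isomorphisms, (small) direct
products, direct limits (colimits over directed sets) and pure submodules. -/
structure IsDefinableSubcategory {R : Type u} [SmallCategory R] [Preadditive R]
    (𝒟 : ObjectProperty (LMod R)) : Prop where
  iso : 𝒟.IsClosedUnderIsomorphisms
  products : ∀ J : Type u, 𝒟.IsClosedUnderLimitsOfShape (Discrete J)
  directLimits : ∀ (J : Type u) [PartialOrder J] [IsDirectedOrder J] [Nonempty J],
    𝒟.IsClosedUnderColimitsOfShape J
  pure : ∀ ⦃A B : LMod R⦄ (f : A ⟶ B), IsPureEmbedding f → 𝒟 B → 𝒟 A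

/-- `D` is a (possibly infinite, possibly empty) direct sum of copies of members of the
family `N`. -/
def IsDirectSumOfCopies {R : Type u} [SmallCategory R] [Preadditive R] {ι : Type} (N : ι → LMod R)
    (D : LMod R) : Prop :=
  ∃ (I : Type u) (k : I → ι) (c : Cofan fun i => N (k i)),
    Nonempty (IsColimit c) ∧ Nonempty (c.pt ≅ D)

/-! ### Finitely presented functors -/

/-- `F : R-Mod ⥤ Ab` is additive and has a presentation `(Y, -) ⟶ (X, -) ⟶ F ⟶ 0` by functors
represented by finitely presented modules `X`, `Y`, the first arrow being induced by some
`f : X ⟶ Y`. These functors are exactly the canonical extensions to `R-Mod`, commuting with direct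
limits, of the finitely presented additive functors on the category of finitely presented
`R`-modules. -/
def IsFPFunctor {R : Type u} [SmallCategory R] [Preadditive R]
    (F : LMod R ⥤ AddCommGrpCat.{u}) : Prop :=
  F.Additive ∧
  ∃ (X Y : LMod R) (f : X ⟶ Y) (π : preadditiveCoyoneda.obj (op X) ⟶ F),
    IsFinitelyPresentable.{u} X ∧ IsFinitelyPresentable.{u} Y ∧
    ∀ D : LMod R, Function.Surjective (π.app D) ∧
      ∀ x : X ⟶ D, π.app D x = 0 ↔ ∃ y : Y ⟶ D, f ≫ y = x

/-- The free abelian category on `R`, realised as the category `(R-mod, Ab)^fp` of finitely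
presented functors on finitely presented modules, each functor being regarded, through its extension
commuting with direct limits, as acting on all of `R-Mod`. -/
abbrev FreeAb (R : Type u) [SmallCategory R] [Preadditive R] :=
  ObjectProperty.FullSubcategory (IsFPFunctor (R := R))

/-- The Serre subcategory `𝒮_𝒟` of those functors that vanish on every module in `𝒟`. -/
def vanishingOn {R : Type u} [SmallCategory R] [Preadditive R] (𝒟 : ObjectProperty (LMod R)) :
    ObjectProperty (FreeAb R) :=
  fun F => ∀ D : LMod R, 𝒟 D → ∀ x : F.obj.obj D, x = 0

/-- The morphisms of `𝒜` that have a kernel and a cokernel lying in `𝒮`. If `𝒜` is abelian and `𝒮`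
is a Serre subcategory, then the localisation of `𝒜` at these morphisms is the quotient abelian
category `𝒜/𝒮`. -/
def isoModulo {𝒜 : Type*} [Category 𝒜] [HasZeroMorphisms 𝒜] (𝒮 : ObjectProperty 𝒜) :
    MorphismProperty 𝒜 := fun _ _ f =>
  (∃ k : KernelFork f, Nonempty (IsLimit k) ∧ 𝒮 k.pt) ∧
  (∃ c : CokernelCofork f, Nonempty (IsColimit c) ∧ 𝒮 c.pt)

/-- The functor category `𝒜(𝒟) = Ab(R)/𝒮_𝒟` of `𝒟`, that is, the category of pp-pairs for `𝒟`. -/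
abbrev FunctorCategory {R : Type u} [SmallCategory R] [Preadditive R]
    (𝒟 : ObjectProperty (LMod R)) :=
  (isoModulo (vanishingOn 𝒟)).Localization

/-- The quotient functor `Ab(R) ⥤ Ab(R)/𝒮_𝒟 = 𝒜(𝒟)`. -/
abbrev quotientFunctor {R : Type u} [SmallCategory R] [Preadditive R]
    (𝒟 : ObjectProperty (LMod R)) : FreeAb R ⥤ FunctorCategory 𝒟 :=
  (isoModulo (vanishingOn 𝒟)).Q

/-! ### Modules over the endomorphism ring

In Mathlib multiplication in `End M` is composition of maps, `s * t = t ≫ s`, so that `End M` acts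
on the left of `M`, and `Hom(D, M)` is a left `End M`-module under `s • f = f ≫ s`. -/

/-- The category `S-mod` of finitely presented left `S`-modules. -/
abbrev FPMod (S : Type u) [Ring S] :=
  ObjectProperty.FullSubcategory
    (fun A : ModuleCat.{u} S => Module.FinitePresentation S A)

/-- The left `End M`-module structure of `F M`: `s` acts as `F s`. -/
abbrev evalModuleStructure {R : Type u} [SmallCategory R] [Preadditive R] (M : LMod R)
    (F : FreeAb R) : Module (End M) (F.obj.obj M) where
  smul s x := F.obj.map s x
  one_smul x := by
    change F.obj.map (𝟙 M) x = x
    simp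
  mul_smul s t x := by
    change F.obj.map (t ≫ s) x = F.obj.map s (F.obj.map t x)
    simp
  smul_zero s := map_zero (F.obj.map s).hom
  smul_add s := map_add (F.obj.map s).hom
  add_smul s t x := by
    have := F.property.1
    change F.obj.map (s + t) x = F.obj.map s x + F.obj.map t x
    rw [F.obj.map_add]; rfl
  zero_smul x := by
    have := F.property.1
    change F.obj.map (0 : M ⟶ M) x = 0
    rw [F.obj.map_zero]; rfl

/-- Evaluation at `M`, `F ↦ F M`, as a functor from `Ab(R)` to left `End M`-modules. -/
def evalFunctor {R : Type u} [SmallCategory R] [Preadditive R] (M : LMod R) :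
    FreeAb R ⥤ ModuleCat.{u} (End M) where
  obj F :=
    letI := evalModuleStructure M F
    ModuleCat.of (End M) (F.obj.obj M)
  map {F G} α :=
    letI := evalModuleStructure M F
    letI := evalModuleStructure M G
    ModuleCat.ofHom
      { toFun := fun x => α.hom.app M x
        map_add' := fun x y => map_add (α.hom.app M).hom x y
        map_smul' := fun s x => NatTrans.naturality_apply α.hom s x }

/-- The functor `D ↦ Hom_S(Hom_R(D, M), A)` on `R-Mod`, for `S = End M` and `A` an `S`-module. -/
def homHom {R : Type u} [SmallCategory R] [Preadditive R] (M : LMod R)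
    (A : ModuleCat.{u} (End M)) : LMod R ⥤ AddCommGrpCat.{u} where
  obj D := AddCommGrpCat.of ((D ⟶ M) →ₗ[End M] A)
  map {D D'} g := AddCommGrpCat.ofHom
    { toFun := fun φ =>
        { toFun := fun h => φ (g ≫ h)
          map_add' := fun h h' => by simp
          map_smul' := fun s h => by
            change φ (g ≫ h ≫ s) = s • φ (g ≫ h)
            rw [← map_smul, ← Category.assoc]; rfl }
      map_zero' := rfl
      map_add' := fun _ _ => rfl }
  map_id D := by
    ext φ h
    change φ (𝟙 D ≫ h) = φ h
    rw [Category.id_comp]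
  map_comp g g' := by
    ext φ h
    change φ ((g ≫ g') ≫ h) = φ (g ≫ g' ≫ h)
    rw [Category.assoc]

/-!
Write `M = c.pt` and `S = End M`. The proof shows that evaluation at `M`, as a functor from `Ab(R)`
to finitely presented `S`-modules, is a localisation at the very morphisms that are inverted in
`Ab(R)/𝒮_𝒟`; the equivalence is then the uniqueness of localisations.

A finitely presented functor `F` is handled through an element `u ∈ F X` and a map `f : X ⟶ Y` such
that `(Y, -) ⟶ (X, -) ⟶ F ⟶ 0` is exact, the second map being `g ↦ F g u` (`IsPresentedBy`). From
such presentations one reads off that `Ab(R)` has pointwise kernels (presented by pushouts) and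
cokernels, so that a morphism is inverted in `Ab(R)/𝒮_𝒟` if and only if it is bijective at `M`
(`isoModulo_vanishingOn_iff`).

The one fact about `𝒟` behind everything is that a map `X ⟶ D` from a finitely presented module to a
direct sum of copies of the `N i` is a finite sum of maps that factor through `M`
(`IsDirectSumOfCopies.exists_eq_sum`). It shows that

* a functor vanishing at `M` vanishes on `𝒟` (`eq_zero_of_factorization`);
* `Hom(X, M)` is a finitely generated `S`-module for finitely presented `X`: apply the fact to the
  canonical map from `X` to the power `M ^ Hom(X, M)`, which lies in `𝒟` (`module_finite_hom`). If
  finitely many elements generate, the relations between them are the maps to `M` from the cokernel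
  of the corresponding `X ⟶ Mⁿ`, so `Hom(X, M)`, and with it `F M`, is finitely presented
  (`finitePresentation_evalFunctor`);
* the identity of a finitely presented `D` in `𝒟` is a finite sum of maps through `M`, which makes
  `x ↦ (h ↦ F h x)` an isomorphism `F D ≅ Hom_S(Hom_R(D, M), F M)` (`evalToHomHom_app_bijective`).

Evaluation at `M` has a fully faithful left adjoint, and is therefore a localisation at the
morphisms it inverts (`fpEvalFunctor_isLocalization`). The adjoint sends the cokernel of a matrix
`Sᵐ ⟶ Sⁿ` to the cokernel of the corresponding `(Mᵐ, -) ⟶ (Mⁿ, -)`; the universal property is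
`evalFunctor_map_bijective`, and the unit is an isomorphism by
`exists_isPresentedBy_evalFunctor_iso`.
-/

/-! ### Limits and colimits of modules -/

section Additive

variable {C D J : Type*} [Category* C] [Category* D] [Category* J] [Preadditive C] [Preadditive D]

instance additiveFunctor_isClosedUnderColimitsOfShape [HasColimitsOfShape J D] :
    (additiveFunctor C D).IsClosedUnderColimitsOfShape J where
  colimitsOfShape_le := by
    rintro F ⟨⟨hc, hadd⟩⟩
    refine ⟨fun {X Y f g} => ?_⟩
    apply (isColimitOfPreserves ((evaluation C D).obj X) hc.isColimit).hom_ext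
    intro j
    have : (hc.diag.obj j).Additive := hadd j
    simp [← NatTrans.naturality]

instance additiveFunctor_isClosedUnderLimitsOfShape [HasLimitsOfShape J D] :
    (additiveFunctor C D).IsClosedUnderLimitsOfShape J where
  limitsOfShape_le := by
    rintro F ⟨⟨hc, hadd⟩⟩
    refine ⟨fun {X Y f g} => ?_⟩
    apply (isLimitOfPreserves ((evaluation C D).obj Y) hc.isLimit).hom_ext
    intro j
    have : (hc.diag.obj j).Additive := hadd j
    simp

end Additive

section

variable {R : Type u} [SmallCategory R] [Preadditive R]

instance : HasColimitsOfSize.{u, u} (LMod R) where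

instance : HasLimitsOfSize.{u, u} (LMod R) where

instance : HasFiniteBiproducts (LMod R) := HasFiniteBiproducts.of_hasFiniteCoproducts

instance : HasBinaryBiproducts (LMod R) := HasBinaryBiproducts.of_hasBinaryCoproducts

end

/-! ### Pointwise kernels and cokernels of functors to abelian groups -/

section PointwiseKernels

variable {C : Type*} [Category* C] {F G : C ⥤ AddCommGrpCat.{u}} (α : F ⟶ G)

lemma cokernel_π_app_surjective (D : C) : Function.Surjective ((cokernel.π α).app D) := by
  rw [← AddCommGrpCat.epi_iff_surjective]
  infer_instance

lemma cokernel_π_app_eq_zero_iff {D : C} (x : G.obj D) :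
    (cokernel.π α).app D x = 0 ↔ ∃ y, α.app D y = x := by
  have h := (ShortComplex.exact_cokernel α).map ((evaluation C AddCommGrpCat.{u}).obj D)
  rw [ShortComplex.ab_exact_iff] at h
  refine ⟨h x, ?_⟩
  rintro ⟨y, rfl⟩
  have := ConcreteCategory.congr_hom (NatTrans.congr_app (cokernel.condition α) D) y
  exact this

lemma kernel_ι_app_injective (D : C) : Function.Injective ((kernel.ι α).app D) := by
  rw [← AddCommGrpCat.mono_iff_injective]
  infer_instance

lemma app_eq_zero_iff_exists_kernel {D : C} (x : F.obj D) :
    α.app D x = 0 ↔ ∃ y, (kernel.ι α).app D y = x := by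
  have h := (ShortComplex.exact_kernel α).map ((evaluation C AddCommGrpCat.{u}).obj D)
  rw [ShortComplex.ab_exact_iff] at h
  refine ⟨h x, ?_⟩
  rintro ⟨y, rfl⟩
  have := ConcreteCategory.congr_hom (NatTrans.congr_app (kernel.condition α) D) y
  exact this

end PointwiseKernels

section PointwiseKernels

variable {C : Type*} [Category* C] [Preadditive C]

instance kernel_additive {F G : C ⥤ AddCommGrpCat.{u}} [F.Additive] (α : F ⟶ G) :
    (kernel α).Additive where
  map_add {X Y f g} := by
    rw [← cancel_mono ((kernel.ι α).app Y)]
    simp [Preadditive.add_comp]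

instance cokernel_additive {F G : C ⥤ AddCommGrpCat.{u}} [G.Additive] (α : F ⟶ G) :
    (cokernel α).Additive where
  map_add {X Y f g} := by
    rw [← cancel_epi ((cokernel.π α).app X)]
    simp [← NatTrans.naturality]

end PointwiseKernels

/-! ### Presented functors -/

section Presented

variable {C : Type*} [Category.{u} C] [Preadditive C]

/-- `F` is presented by `f : X ⟶ Y` through `u ∈ F X`: the map `(X, -) ⟶ F`, `g ↦ F g u`, that
corresponds to `u` is pointwise surjective, and its kernel is the image of `(Y, -)` under `f`. Thus
`(Y, -) ⟶ (X, -) ⟶ F ⟶ 0` is exact. -/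
structure IsPresentedBy (F : C ⥤ AddCommGrpCat.{u}) {X Y : C} (f : X ⟶ Y) (u : F.obj X) : Prop where
  exists_map_eq ⦃D : C⦄ (x : F.obj D) : ∃ g : X ⟶ D, F.map g u = x
  map_eq_zero_iff ⦃D : C⦄ (g : X ⟶ D) : F.map g u = 0 ↔ ∃ y : Y ⟶ D, f ≫ y = g

lemma map_add_apply (F : C ⥤ AddCommGrpCat.{u}) [F.Additive] {X Y : C} (g h : X ⟶ Y) (x : F.obj X) :
    F.map (g + h) x = F.map g x + F.map h x := by
  rw [F.map_add]; rfl

lemma map_sub_apply (F : C ⥤ AddCommGrpCat.{u}) [F.Additive] {X Y : C} (g h : X ⟶ Y) (x : F.obj X) :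
    F.map (g - h) x = F.map g x - F.map h x := by
  rw [F.map_sub]; rfl

lemma map_zero_apply (F : C ⥤ AddCommGrpCat.{u}) [F.Additive] {X Y : C} (x : F.obj X) :
    F.map (0 : X ⟶ Y) x = 0 := by
  rw [F.map_zero]; rfl

lemma map_sum_apply (F : C ⥤ AddCommGrpCat.{u}) [F.Additive] {X Y : C} {ι : Type*} (s : Finset ι)
    (g : ι → (X ⟶ Y)) (x : F.obj X) :
    F.map (∑ i ∈ s, g i) x = ∑ i ∈ s, F.map (g i) x := by
  classical
  induction s using Finset.induction_on with
  | empty => exact map_zero_apply F x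
  | insert i s hi ih => rw [Finset.sum_insert hi, Finset.sum_insert hi, map_add_apply, ih]

omit [Preadditive C] in
lemma map_comp_apply (F : C ⥤ AddCommGrpCat.{u}) {X Y Z : C} (g : X ⟶ Y) (h : Y ⟶ Z) (x : F.obj X) :
    F.map (g ≫ h) x = F.map h (F.map g x) := by
  simp

/-- The natural transformation `(X, -) ⟶ F` that corresponds to `u ∈ F X` by the Yoneda lemma. -/
def homOfElement (F : C ⥤ AddCommGrpCat.{u}) [F.Additive] {X : C} (u : F.obj X) :
    preadditiveCoyoneda.obj (op X) ⟶ F where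
  app D := AddCommGrpCat.ofHom (AddMonoidHom.mk' (fun g : X ⟶ D => F.map g u)
    fun g h => map_add_apply F g h u)
  naturality D D' h := by
    ext g
    exact map_comp_apply F g h u

lemma hom_coyoneda_app {F : C ⥤ AddCommGrpCat.{u}} {X D : C}
    (π : preadditiveCoyoneda.obj (op X) ⟶ F) (g : X ⟶ D) :
    π.app D g = F.map g (π.app X (𝟙 X)) := by
  have := NatTrans.naturality_apply π g (𝟙 X)
  rw [← this]
  change π.app D g = π.app D (𝟙 X ≫ g)
  rw [Category.id_comp]

namespace IsPresentedBy

variable {F G : C ⥤ AddCommGrpCat.{u}} {X Y : C} {f : X ⟶ Y} {u : F.obj X}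

omit [Preadditive C] in
lemma map_relation (h : IsPresentedBy F f u) : F.map f u = 0 :=
  (h.map_eq_zero_iff f).2 ⟨𝟙 Y, Category.comp_id f⟩

omit [Preadditive C] in
lemma hom_ext (h : IsPresentedBy F f u) {α β : F ⟶ G} (hαβ : α.app X u = β.app X u) : α = β := by
  ext D x
  obtain ⟨g, rfl⟩ := h.exists_map_eq x
  rw [NatTrans.naturality_apply, NatTrans.naturality_apply, hαβ]

/-- Elements `v` satisfying the relation `f` are the images of `u` under morphisms out of `F`. -/
lemma exists_hom [F.Additive] [G.Additive] (h : IsPresentedBy F f u) (v : G.obj X)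
    (hv : G.map f v = 0) : ∃ α : F ⟶ G, α.app X u = v := by
  -- The assignment `F g u ↦ G g v` is well defined.
  have key : ∀ {D : C} (g g' : X ⟶ D), F.map g u = F.map g' u → G.map g v = G.map g' v := by
    intro D g g' hg
    obtain ⟨y, hy⟩ := (h.map_eq_zero_iff (g - g')).1 (by rw [map_sub_apply, hg, sub_self])
    rw [← sub_eq_zero, ← map_sub_apply, ← hy, map_comp_apply, hv, map_zero]
  choose r hr using fun (D : C) (x : F.obj D) => h.exists_map_eq x
  refine ⟨{ app := fun D => AddCommGrpCat.ofHom (AddMonoidHom.mk' (fun x => G.map (r D x) v) ?_)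
            naturality := ?_ }, ?_⟩
  · intro x y
    rw [← map_add_apply]
    apply key
    rw [map_add_apply, hr, hr, hr]
  · intro D D' k
    ext x
    change G.map (r D' (F.map k x)) v = G.map k (G.map (r D x) v)
    rw [← map_comp_apply]
    apply key
    rw [map_comp_apply, hr, hr]
  · change G.map (r X u) v = v
    conv_rhs => rw [← (show G.map (𝟙 X) v = v by simp)]
    apply key
    rw [hr]; simp

/-- Elements of `F` and equalities between them are witnessed by maps out of `X` and `Y`, which
factor through a stage of a filtered colimit. -/
lemma preservesFilteredColimitsOfSize [F.Additive] (h : IsPresentedBy F f u)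
    [IsFinitelyPresentable.{u} X] [IsFinitelyPresentable.{u} Y] :
    PreservesFilteredColimitsOfSize.{u, u} F where
  preserves_filtered_colimits J _ _ := ⟨fun {K} => ⟨fun {c} hc => by
    have : ReflectsColimitsOfShape J (CategoryTheory.forget AddCommGrpCat.{u}) :=
      reflectsColimitsOfShape_of_reflectsIsomorphisms
    refine ⟨isColimitOfReflects (CategoryTheory.forget AddCommGrpCat) ?_⟩
    refine Types.FilteredColimit.isColimitOf' _ _ ?_ ?_
    · intro (x : F.obj c.pt)
      obtain ⟨g, rfl⟩ := h.exists_map_eq x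
      obtain ⟨j, p, rfl⟩ := IsFinitelyPresentable.exists_hom_of_isColimit hc g
      exact ⟨j, F.map p u, map_comp_apply F _ _ u⟩
    · intro j (x : F.obj (K.obj j)) (y : F.obj (K.obj j))
        (hxy : F.map (c.ι.app j) x = F.map (c.ι.app j) y)
      obtain ⟨g, hg⟩ := h.exists_map_eq (x - y)
      obtain ⟨z, hz⟩ := (h.map_eq_zero_iff (g ≫ c.ι.app j)).1 (by
        rw [map_comp_apply, hg, map_sub, hxy, sub_self])
      obtain ⟨k, z, rfl⟩ := IsFinitelyPresentable.exists_hom_of_isColimit hc z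
      obtain ⟨l, a, b, hab⟩ := IsFinitelyPresentable.exists_eq_of_isColimit hc g (f ≫ z)
        (by rw [← hz, Category.assoc])
      refine ⟨l, a, ?_⟩
      change F.map (K.map a) x = F.map (K.map a) y
      rw [← sub_eq_zero, ← map_sub, ← hg, ← map_comp_apply, hab, Category.assoc, map_comp_apply,
        h.map_relation, map_zero]⟩⟩

end IsPresentedBy

lemma exists_isPresentedBy {X Y : C} (f : X ⟶ Y) :
    ∃ (F : C ⥤ AddCommGrpCat.{u}) (u : F.obj X), F.Additive ∧ IsPresentedBy F f u := by
  let α := preadditiveCoyoneda.map f.op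
  refine ⟨cokernel α, (cokernel.π α).app X (𝟙 X), inferInstance, ⟨fun D x => ?_, fun D g => ?_⟩⟩
  · obtain ⟨g, rfl⟩ := cokernel_π_app_surjective α D x
    exact ⟨g, (hom_coyoneda_app (cokernel.π α) g).symm⟩
  · rw [← hom_coyoneda_app]
    exact cokernel_π_app_eq_zero_iff α g

/-- The elements of the kernel are the `F g u` for which `φ ≫ g` factors through `f'`, that is,
for which `g` extends to the pushout of `φ` and `f'`. A second pushout accounts for the
relation `f`. -/
lemma IsPresentedBy.kernel [HasPushouts C] {F G : C ⥤ AddCommGrpCat.{u}} [F.Additive] [G.Additive]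
    {X Y X' Y' : C} {f : X ⟶ Y} {u : F.obj X} {f' : X' ⟶ Y'} {u' : G.obj X'}
    (hF : IsPresentedBy F f u) (hG : IsPresentedBy G f' u') (α : F ⟶ G) {φ : X' ⟶ X}
    (hφ : G.map φ u' = α.app X u) :
    ∃ k, IsPresentedBy (Limits.kernel α) (pushout.inl (pushout.inl φ f') f) k := by
  have hw : α.app (pushout φ f') (F.map (pushout.inl φ f') u) = 0 := by
    rw [NatTrans.naturality_apply, ← hφ, ← map_comp_apply, pushout.condition, map_comp_apply,
      hG.map_relation, map_zero]
  obtain ⟨k, hk⟩ := (app_eq_zero_iff_exists_kernel α _).1 hw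
  refine ⟨k, fun D x => ?_, fun D p => ?_⟩
  · obtain ⟨g, hg⟩ := hF.exists_map_eq ((kernel.ι α).app D x)
    have h0 : α.app D (F.map g u) = 0 := (app_eq_zero_iff_exists_kernel α _).2 ⟨x, hg.symm⟩
    rw [NatTrans.naturality_apply, ← hφ, ← map_comp_apply, hG.map_eq_zero_iff] at h0
    obtain ⟨y, hy⟩ := h0
    refine ⟨pushout.desc g y hy.symm, kernel_ι_app_injective α D ?_⟩
    rw [NatTrans.naturality_apply, hk, ← map_comp_apply, pushout.inl_desc, hg]
  · have : (Limits.kernel α).map p k = 0 ↔ F.map (pushout.inl φ f' ≫ p) u = 0 := by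
      rw [map_comp_apply, ← hk, ← NatTrans.naturality_apply,
        ← map_zero ((kernel.ι α).app D).hom]
      exact (kernel_ι_app_injective α D).eq_iff.symm
    rw [this, hF.map_eq_zero_iff]
    constructor
    · rintro ⟨y, hy⟩
      exact ⟨pushout.desc p y hy.symm, pushout.inl_desc _ _ _⟩
    · rintro ⟨q, rfl⟩
      exact ⟨pushout.inr _ _ ≫ q, by rw [← Category.assoc, ← pushout.condition, Category.assoc]⟩

/-- The cokernel is generated by the generator `u'` of `G`, subject to its relation `f'` and to the
vanishing of the image `G φ u'` of the generator of `F`. -/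
lemma IsPresentedBy.cokernel [HasBinaryBiproducts C] {F G : C ⥤ AddCommGrpCat.{u}} [G.Additive]
    {X Y X' Y' : C} {f : X ⟶ Y} {u : F.obj X} {f' : X' ⟶ Y'} {u' : G.obj X'}
    (hF : IsPresentedBy F f u) (hG : IsPresentedBy G f' u') (α : F ⟶ G) {φ : X' ⟶ X}
    (hφ : G.map φ u' = α.app X u) :
    IsPresentedBy (Limits.cokernel α) (biprod.lift f' φ) ((cokernel.π α).app X' u') := by
  refine ⟨fun D x => ?_, fun D g => ?_⟩
  · obtain ⟨x, rfl⟩ := cokernel_π_app_surjective α D x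
    obtain ⟨g, rfl⟩ := hG.exists_map_eq x
    exact ⟨g, (NatTrans.naturality_apply _ _ _).symm⟩
  · rw [← NatTrans.naturality_apply, cokernel_π_app_eq_zero_iff]
    constructor
    · rintro ⟨x, hx⟩
      obtain ⟨h, rfl⟩ := hF.exists_map_eq x
      rw [NatTrans.naturality_apply, ← hφ, ← map_comp_apply, eq_comm, ← sub_eq_zero,
        ← map_sub_apply, hG.map_eq_zero_iff] at hx
      obtain ⟨y, hy⟩ := hx
      exact ⟨biprod.desc y h, by rw [biprod.lift_desc, hy, sub_add_cancel]⟩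
    · rintro ⟨y, rfl⟩
      refine ⟨F.map (biprod.inr ≫ y) u, ?_⟩
      rw [NatTrans.naturality_apply, ← hφ, ← map_comp_apply]
      conv_rhs => rw [biprod.lift_eq, Preadditive.add_comp, map_add_apply, Category.assoc,
        map_comp_apply, hG.map_relation, map_zero, zero_add]
      rw [Category.assoc]

end Presented

/-! ### The category of finitely presented functors -/

section FreeAb

lemma isFinitelyPresentable_of_isColimit {C : Type*} [Category.{u} C] {J : Type} [SmallCategory J]
    [FinCategory J] {K : J ⥤ C} {c : Cocone K} (hc : IsColimit c)
    (hK : ∀ j, IsFinitelyPresentable.{u} (K.obj j)) : IsFinitelyPresentable.{u} c.pt := by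
  have : Fact Cardinal.aleph0.{u}.IsRegular := Cardinal.fact_isRegular_aleph0
  have : ∀ j, IsCardinalPresentable.{u} (K.obj j) Cardinal.aleph0.{u} := hK
  exact isCardinalPresentable_of_isColimit.{u} c hc _ (by
    rw [hasCardinalLT_aleph0_iff]
    infer_instance)

variable {R : Type u} [SmallCategory R] [Preadditive R]

/-- `IsFPFunctor` in terms of the element of `F X` that corresponds to the map `(X, -) ⟶ F`. -/
lemma isFPFunctor_iff {F : LMod R ⥤ AddCommGrpCat.{u}} :
    IsFPFunctor F ↔ F.Additive ∧ ∃ (X Y : LMod R) (f : X ⟶ Y) (u : F.obj X),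
      IsFinitelyPresentable.{u} X ∧ IsFinitelyPresentable.{u} Y ∧ IsPresentedBy F f u := by
  refine and_congr_right fun _ => ⟨?_, ?_⟩
  · rintro ⟨X, Y, f, π, hX, hY, h⟩
    refine ⟨X, Y, f, π.app X (𝟙 X), hX, hY, fun D x => ?_, fun D g => ?_⟩
    · obtain ⟨g, rfl⟩ := (h D).1 x
      exact ⟨g, (hom_coyoneda_app π g).symm⟩
    · rw [← hom_coyoneda_app]
      exact (h D).2 g
  · rintro ⟨X, Y, f, u, hX, hY, h⟩
    exact ⟨X, Y, f, homOfElement F u, hX, hY, fun D => ⟨h.exists_map_eq (D := D),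
      h.map_eq_zero_iff (D := D)⟩⟩

instance (F : FreeAb R) : F.obj.Additive := F.property.1

lemma FreeAb.exists_isPresentedBy (F : FreeAb R) :
    ∃ (X Y : LMod R) (f : X ⟶ Y) (u : F.obj.obj X),
      IsFinitelyPresentable.{u} X ∧ IsFinitelyPresentable.{u} Y ∧ IsPresentedBy F.obj f u :=
  (isFPFunctor_iff.1 F.property).2

lemma isFinitelyPresentable_pushout {X Y Z : LMod R} (f : X ⟶ Y) (g : X ⟶ Z)
    (hX : IsFinitelyPresentable.{u} X) (hY : IsFinitelyPresentable.{u} Y)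
    (hZ : IsFinitelyPresentable.{u} Z) : IsFinitelyPresentable.{u} (pushout f g) :=
  isFinitelyPresentable_of_isColimit (colimit.isColimit _) (by rintro (_ | _ | _) <;> assumption)

lemma isFinitelyPresentable_biprod {X Y : LMod R}
    (hX : IsFinitelyPresentable.{u} X) (hY : IsFinitelyPresentable.{u} Y) :
    IsFinitelyPresentable.{u} (X ⊞ Y) :=
  isFinitelyPresentable_of_isColimit (BinaryBiproduct.isColimit X Y)
    (by rintro ⟨_ | _⟩ <;> assumption)

lemma isFinitelyPresentable_biproduct {n : ℕ} (X : Fin n → LMod R)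
    (hX : ∀ i, IsFinitelyPresentable.{u} (X i)) : IsFinitelyPresentable.{u} (⨁ X) :=
  isFinitelyPresentable_of_isColimit (biproduct.isColimit X) fun j => hX j.as

lemma isFinitelyPresentable_cokernel {X Y : LMod R} (f : X ⟶ Y)
    (hX : IsFinitelyPresentable.{u} X) (hY : IsFinitelyPresentable.{u} Y) :
    IsFinitelyPresentable.{u} (cokernel f) :=
  isFinitelyPresentable_of_isColimit (colimit.isColimit _) (by rintro (_ | _) <;> assumption)

lemma isFPFunctor_kernel {F G : FreeAb R} (α : F ⟶ G) : IsFPFunctor (kernel α.hom) := by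
  obtain ⟨X, Y, f, u, hX, hY, hF⟩ := F.exists_isPresentedBy
  obtain ⟨X', Y', f', u', hX', hY', hG⟩ := G.exists_isPresentedBy
  obtain ⟨φ, hφ⟩ := hG.exists_map_eq (α.hom.app X u)
  obtain ⟨k, hk⟩ := hF.kernel hG α.hom hφ
  have hP := isFinitelyPresentable_pushout φ f' hX' hX hY'
  exact isFPFunctor_iff.2 ⟨inferInstance, _, _, _, k, hP,
    isFinitelyPresentable_pushout _ _ hX hP hY, hk⟩

lemma isFPFunctor_cokernel {F G : FreeAb R} (α : F ⟶ G) : IsFPFunctor (cokernel α.hom) := by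
  obtain ⟨X, Y, f, u, hX, hY, hF⟩ := F.exists_isPresentedBy
  obtain ⟨X', Y', f', u', hX', hY', hG⟩ := G.exists_isPresentedBy
  obtain ⟨φ, hφ⟩ := hG.exists_map_eq (α.hom.app X u)
  exact isFPFunctor_iff.2 ⟨inferInstance, _, _, _, _, hX', isFinitelyPresentable_biprod hY' hX,
    hF.cokernel hG α.hom hφ⟩

lemma FreeAb.hom_comp_eq_zero {F G H : FreeAb R} {α : F ⟶ G} {β : G ⟶ H} (h : α ≫ β = 0) :
    α.hom ≫ β.hom = 0 := congrArg (fun γ : F ⟶ H => γ.hom) h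

/-- The pointwise kernel of a morphism of finitely presented functors. -/
noncomputable def kernelFork {F G : FreeAb R} (α : F ⟶ G) : KernelFork α :=
  KernelFork.ofι (Z := ⟨kernel α.hom, isFPFunctor_kernel α⟩)
    (ObjectProperty.homMk (kernel.ι α.hom)) (by ext1; exact kernel.condition _)

/-- The pointwise kernel is a kernel in `Ab(R)`. -/
noncomputable def isLimitKernelFork {F G : FreeAb R} (α : F ⟶ G) : IsLimit (kernelFork α) :=
  KernelFork.IsLimit.ofι _ (by ext1; exact kernel.condition α.hom)
    (fun g hg => ObjectProperty.homMk (kernel.lift α.hom g.hom (FreeAb.hom_comp_eq_zero hg)))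
    (fun g hg => by ext1; exact kernel.lift_ι _ _ _)
    (fun g hg m hm => by
      ext1
      rw [← cancel_mono (kernel.ι α.hom)]
      exact (congrArg (fun γ : _ ⟶ F => γ.hom) hm).trans (kernel.lift_ι _ _ _).symm)

/-- The pointwise cokernel of a morphism of finitely presented functors. -/
noncomputable def cokernelCofork {F G : FreeAb R} (α : F ⟶ G) : CokernelCofork α :=
  CokernelCofork.ofπ (Z := ⟨cokernel α.hom, isFPFunctor_cokernel α⟩)
    (ObjectProperty.homMk (cokernel.π α.hom)) (by ext1; exact cokernel.condition _)

/-- The pointwise cokernel is a cokernel in `Ab(R)`. -/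
noncomputable def isColimitCokernelCofork {F G : FreeAb R} (α : F ⟶ G) :
    IsColimit (cokernelCofork α) :=
  CokernelCofork.IsColimit.ofπ _ (by ext1; exact cokernel.condition α.hom)
    (fun g hg => ObjectProperty.homMk (cokernel.desc α.hom g.hom (FreeAb.hom_comp_eq_zero hg)))
    (fun g hg => by ext1; exact cokernel.π_desc _ _ _)
    (fun g hg m hm => by
      ext1
      rw [← cancel_epi (cokernel.π α.hom)]
      exact (congrArg (fun γ : G ⟶ _ => γ.hom) hm).trans (cokernel.π_desc _ _ _).symm)

lemma vanishingOn_of_iso {𝒟 : ObjectProperty (LMod R)} {F G : FreeAb R} (e : F ≅ G)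
    (hF : vanishingOn 𝒟 F) : vanishingOn 𝒟 G := fun D hD x => by
  have h : e.inv.hom ≫ e.hom.hom = 𝟙 G.obj := congrArg (fun γ : G ⟶ G => γ.hom) e.inv_hom_id
  have := ConcreteCategory.congr_hom (NatTrans.congr_app h D) x
  change e.hom.hom.app D (e.inv.hom.app D x) = x at this
  rw [← this, hF D hD (e.inv.hom.app D x), map_zero]

/-- If `M` lies in `𝒟` and detects vanishing on `𝒟`, then the morphisms inverted in `Ab(R)/𝒮_𝒟` are
those inverted by evaluation at `M`, since kernels and cokernels are computed pointwise. -/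
lemma isoModulo_vanishingOn_iff {𝒟 : ObjectProperty (LMod R)} {M : LMod R} (hM : 𝒟 M)
    (h𝒟 : ∀ F : FreeAb R, (∀ x : F.obj.obj M, x = 0) → vanishingOn 𝒟 F) {F G : FreeAb R}
    (α : F ⟶ G) : isoModulo (vanishingOn 𝒟) α ↔ Function.Bijective (α.hom.app M) := by
  refine and_congr ⟨?_, fun h => ?_⟩ ⟨?_, fun h => ?_⟩
  · rintro ⟨k, ⟨hk⟩, hk0⟩
    have := vanishingOn_of_iso (hk.conePointUniqueUpToIso (isLimitKernelFork α)) hk0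
    rw [injective_iff_map_eq_zero]
    intro x hx
    obtain ⟨y, rfl⟩ := (app_eq_zero_iff_exists_kernel α.hom x).1 hx
    have hy : y = 0 := this M hM y
    rw [hy, map_zero]
  · refine ⟨_, ⟨isLimitKernelFork α⟩, h𝒟 _ fun (x : (kernel α.hom).obj M) => ?_⟩
    change x = 0
    apply kernel_ι_app_injective α.hom M
    rw [map_zero]
    exact h (((app_eq_zero_iff_exists_kernel α.hom _).2 ⟨x, rfl⟩).trans (map_zero _).symm)
  · rintro ⟨c, ⟨hc⟩, hc0⟩ x
    have := vanishingOn_of_iso (hc.coconePointUniqueUpToIso (isColimitCokernelCofork α)) hc0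
    exact (cokernel_π_app_eq_zero_iff α.hom x).1 (this M hM _)
  · refine ⟨_, ⟨isColimitCokernelCofork α⟩, h𝒟 _ fun x => ?_⟩
    obtain ⟨x, rfl⟩ := cokernel_π_app_surjective α.hom M x
    exact (cokernel_π_app_eq_zero_iff α.hom x).2 (h x)

end FreeAb

/-! ### Maps into direct sums -/

section DirectSums

variable {C : Type*} [Category.{u} C] [Preadditive C] [HasColimitsOfSize.{u, u} C]

/-- The coproduct is the filtered colimit of its finite subcoproducts, so `g` factors through one of
them, and there the identity is the sum of the projections followed by the inclusions. -/
lemma exists_eq_sum_of_coproduct {I : Type u} [DecidableEq I] (f : I → C) {X : C}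
    [IsFinitelyPresentable.{u} X] (g : X ⟶ ∐ f) :
    ∃ s : Finset (Discrete I), g = ∑ i ∈ s, g ≫ Sigma.π f i.as ≫ Sigma.ι f i.as := by
  obtain ⟨s, p, hp⟩ := IsFinitelyPresentable.exists_hom_of_isColimit
    (CoproductsFromFiniteFiltered.isColimitFiniteSubproductsCocone f) g
  refine ⟨s, ?_⟩
  let q : (∐ fun x : s => f x.1.as) ⟶ ∐ f := Sigma.desc fun x => Sigma.ι f x.1.as
  have hq : q ≫ (∑ i ∈ s, Sigma.π f i.as ≫ Sigma.ι f i.as) = q := by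
    refine Sigma.hom_ext _ _ fun i => ?_
    rw [Sigma.ι_desc_assoc, Sigma.ι_desc, Preadditive.comp_sum, Finset.sum_eq_single_of_mem i.1 i.2]
    · rw [← Category.assoc, Sigma.ι_π_eq_id, Category.id_comp]
    · intro j _ hj
      rw [← Category.assoc, Sigma.ι_π_of_ne _ fun h => hj (Discrete.ext h.symm), zero_comp]
  obtain ⟨p, hp⟩ : ∃ p : X ⟶ ∐ fun x : s => f x.1.as, p ≫ q = g := ⟨p, hp⟩
  rw [← Preadditive.comp_sum, ← hp, Category.assoc, hq]

omit [HasColimitsOfSize.{u, u} C] in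
lemma exists_inj_comp_eq_id {ι : Type} (N : ι → C) {c : Cofan N} (hc : IsColimit c) (i : ι) :
    ∃ r : c.pt ⟶ N i, c.inj i ≫ r = 𝟙 (N i) := by
  classical
  refine ⟨Cofan.IsColimit.desc hc fun j => if h : j = i then eqToHom (by rw [h]) else 0, ?_⟩
  rw [Cofan.IsColimit.fac]
  simp

end DirectSums

section

variable {R : Type u} [SmallCategory R] [Preadditive R]

/-- A map from a finitely presented module to a direct sum of copies of the `N i` is a finite sum of
maps that factor through `⨁ i, N i`: it lands in a finite subsum, all of whose terms are summands
of `⨁ i, N i`. -/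
lemma IsDirectSumOfCopies.exists_eq_sum {ι : Type} {N : ι → LMod R} {c : Cofan N}
    (hc : IsColimit c) {X D : LMod R} (hD : IsDirectSumOfCopies N D)
    (hX : IsFinitelyPresentable.{u} X) (g : X ⟶ D) :
    ∃ (J : Type u) (_ : Fintype J) (a : J → (X ⟶ c.pt)) (b : J → (c.pt ⟶ D)),
      g = ∑ j, a j ≫ b j := by
  classical
  obtain ⟨I, k, c', ⟨hc'⟩, ⟨e'⟩⟩ := hD
  let f : I → LMod R := fun i => N (k i)
  let e : D ≅ ∐ f := e'.symm ≪≫ hc'.coconePointUniqueUpToIso (colimit.isColimit _)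
  choose r hr using exists_inj_comp_eq_id N hc
  obtain ⟨s, hs⟩ := exists_eq_sum_of_coproduct f (g ≫ e.hom)
  refine ⟨s, inferInstance, fun j => g ≫ e.hom ≫ Sigma.π f j.1.as ≫ c.inj (k j.1.as),
    fun j => r (k j.1.as) ≫ Sigma.ι f j.1.as ≫ e.inv, ?_⟩
  have h : ∀ j : I, c.inj (k j) ≫ r (k j) ≫ Sigma.ι f j ≫ e.inv = Sigma.ι f j ≫ e.inv := by
    intro j
    rw [← Category.assoc, hr, Category.id_comp]
  simp only [Category.assoc, h]
  rw [Finset.sum_coe_sort s (fun j => g ≫ e.hom ≫ Sigma.π f j.as ≫ Sigma.ι f j.as ≫ e.inv),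
    ← cancel_mono e.hom]
  simpa [Preadditive.sum_comp] using hs

lemma isDirectSumOfCopies_coproduct {t : ℕ} {N : Fin t → LMod R} {c : Cofan N}
    (hc : IsColimit c) : IsDirectSumOfCopies N c.pt := by
  refine ⟨ULift (Fin t), ULift.down, Cofan.mk c.pt fun i => c.inj i.down,
    ⟨Cofan.IsColimit.mk _ (fun s => Cofan.IsColimit.desc hc fun i => s.inj ⟨i⟩) ?_ ?_⟩,
    ⟨Iso.refl _⟩⟩
  · rintro s ⟨i⟩
    exact Cofan.IsColimit.fac hc _ i
  · intro s m hm
    refine Cofan.IsColimit.hom_ext hc _ _ fun i => ?_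
    rw [Cofan.IsColimit.fac]
    exact hm ⟨i⟩

end

/-! ### Finite presentation of the values at `M` -/

section HomModules

variable {C : Type*} [Category.{u} C] [Preadditive C]

lemma end_smul_def {X M : C} (s : End M) (g : X ⟶ M) : s • g = g ≫ s := rfl

/-- If every `h : X ⟶ M` factors through `p : X ⟶ P`, and `p` is a finite sum of maps `a j ≫ b j`
through `M`, then the `a j` generate `Hom(X, M)`. -/
lemma module_finite_hom {X M P : C} (π : (X ⟶ M) → (P ⟶ M)) (p : X ⟶ P)
    (hp : ∀ h, p ≫ π h = h) {J : Type u} [Fintype J] (a : J → (X ⟶ M)) (b : J → (M ⟶ P))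
    (hab : p = ∑ j, a j ≫ b j) : Module.Finite (End M) (X ⟶ M) := by
  refine Module.Finite.of_surjective (Fintype.linearCombination (End M) a) fun h => ?_
  refine ⟨fun j => b j ≫ π h, ?_⟩
  rw [Fintype.linearCombination_apply]
  conv_rhs => rw [← hp h, hab, Preadditive.sum_comp]
  exact Finset.sum_congr rfl fun j _ => (Category.assoc _ _ _).symm

/-- Precomposition with `f`, as a homomorphism of left `End M`-modules. -/
def precompLinear {X Y : C} (f : X ⟶ Y) (M : C) : (Y ⟶ M) →ₗ[End M] (X ⟶ M) where
  toFun g := f ≫ g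
  map_add' _ _ := Preadditive.comp_add _ _ _ _ _ _
  map_smul' s g := (Category.assoc f g s).symm

/-- Generators of `Hom(X, M)` are the components of a map `X ⟶ Mⁿ`, and the module of relations
between them is the image of the maps to `M` from its cokernel. -/
lemma module_finitePresentation_hom [HasFiniteBiproducts C] [HasCokernels C] {X M : C}
    [Module.Finite (End M) (X ⟶ M)]
    (h : ∀ (n : ℕ) (p : X ⟶ ⨁ fun _ : Fin n => M), Module.Finite (End M) (cokernel p ⟶ M)) :
    Module.FinitePresentation (End M) (X ⟶ M) := by
  obtain ⟨n, l, hl⟩ := Module.Finite.exists_fin' (End M) (X ⟶ M)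
  let p : X ⟶ ⨁ fun _ : Fin n => M := biproduct.lift fun j => l (Pi.single j 1)
  have := h n p
  let ρ : (cokernel p ⟶ M) →ₗ[End M] (Fin n → End M) := LinearMap.pi fun j =>
    precompLinear (biproduct.ι (fun _ : Fin n => M) j ≫ cokernel.π p) M
  have hlp : ∀ s : Fin n → End M, l s = p ≫ biproduct.desc s := by
    intro s
    rw [biproduct.lift_desc]
    conv_lhs => rw [pi_eq_sum_univ' s]
    rw [map_sum]
    refine Finset.sum_congr rfl fun j _ => ?_
    rw [map_smul]
    congr 2
  refine Module.finitePresentation_of_surjective l hl ?_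
  have : LinearMap.ker l = LinearMap.range ρ := by
    ext s
    rw [LinearMap.mem_ker, LinearMap.mem_range, hlp]
    constructor
    · intro hs
      refine ⟨cokernel.desc p _ hs, ?_⟩
      ext j
      change (biproduct.ι (fun _ : Fin n => M) j ≫ cokernel.π p) ≫ cokernel.desc p _ hs = s j
      rw [Category.assoc, cokernel.π_desc, biproduct.ι_desc]
    · rintro ⟨z, rfl⟩
      have : biproduct.desc (ρ z) = cokernel.π p ≫ z := by
        refine biproduct.hom_ext' _ _ fun j => ?_
        rw [biproduct.ι_desc, ← Category.assoc]
        rfl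
      rw [this, cokernel.condition_assoc, zero_comp]
  rw [this, LinearMap.range_eq_map]
  exact Module.Finite.fg_top.map ρ

end HomModules

section Eval

variable {R : Type u} [SmallCategory R] [Preadditive R] (M : LMod R)

/-- `g ↦ F g u`, as a homomorphism of left `End M`-modules `Hom(X, M) → F M`. -/
def evalElement (F : FreeAb R) {X : LMod R} (u : F.obj.obj X) :
    (X ⟶ M) →ₗ[End M] (evalFunctor M).obj F where
  toFun g := F.obj.map g u
  map_add' g h := map_add_apply F.obj g h u
  map_smul' s g := map_comp_apply F.obj g s u

variable {M}

lemma finitePresentation_evalFunctor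
    (h : ∀ X : LMod R, IsFinitelyPresentable.{u} X → Module.Finite (End M) (X ⟶ M))
    (hM : IsFinitelyPresentable.{u} M) (F : FreeAb R) :
    Module.FinitePresentation (End M) ((evalFunctor M).obj F) := by
  obtain ⟨X, Y, f, u, hX, hY, hF⟩ := F.exists_isPresentedBy
  have := h X hX
  have := h Y hY
  have : Module.FinitePresentation (End M) (X ⟶ M) := module_finitePresentation_hom fun n p =>
    h _ (isFinitelyPresentable_cokernel p hX (isFinitelyPresentable_biproduct _ fun _ => hM))
  refine Module.finitePresentation_of_surjective (evalElement M F u) (hF.exists_map_eq (D := M)) ?_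
  have : LinearMap.ker (evalElement M F u) = LinearMap.range (precompLinear f M) := by
    ext g
    exact hF.map_eq_zero_iff g
  rw [this, LinearMap.range_eq_map]
  exact Module.Finite.fg_top.map _

end Eval

/-! ### Evaluation at `M` is a localisation -/

section Adjoint

variable {R : Type u} [SmallCategory R] [Preadditive R] {M : LMod R}

lemma eq_sum_map_of_biproduct {n : ℕ} (F : FreeAb R) (x : F.obj.obj (⨁ fun _ : Fin n => M)) :
    x = ∑ j, F.obj.map (biproduct.ι (fun _ : Fin n => M) j)
      (F.obj.map (biproduct.π (fun _ : Fin n => M) j) x) := by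
  have h := congrArg (fun g => F.obj.map g x) (biproduct.total (f := fun _ : Fin n => M))
  simp only [map_sum_apply, map_comp_apply, CategoryTheory.Functor.map_id] at h
  exact h.symm

lemma ext_of_biproduct {n : ℕ} (F : FreeAb R) {x y : F.obj.obj (⨁ fun _ : Fin n => M)}
    (h : ∀ j, F.obj.map (biproduct.π (fun _ : Fin n => M) j) x =
      F.obj.map (biproduct.π (fun _ : Fin n => M) j) y) : x = y := by
  rw [eq_sum_map_of_biproduct F x, eq_sum_map_of_biproduct F y]
  simp only [h]

/-- Evaluation at `M` is fully faithful on morphisms out of a functor presented by a map between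
finite powers of `M`: both sides amount to families of `n` elements of `F M` subject to the
relations `f`. -/
lemma evalFunctor_map_bijective {H : FreeAb R} {n m : ℕ}
    {f : (⨁ fun _ : Fin n => M) ⟶ ⨁ fun _ : Fin m => M}
    {u : H.obj.obj (⨁ fun _ : Fin n => M)} (hH : IsPresentedBy H.obj f u) (F : FreeAb R) :
    Function.Bijective (fun α : H ⟶ F => (evalFunctor M).map α) := by
  constructor
  · intro α β h
    have h' : ∀ x : H.obj.obj M, α.hom.app M x = β.hom.app M x := fun x =>
      ConcreteCategory.congr_hom h x
    ext1
    refine hH.hom_ext (ext_of_biproduct F fun j => ?_)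
    rw [← NatTrans.naturality_apply, ← NatTrans.naturality_apply, h']
  · intro g
    let γ : H.obj.obj M → F.obj.obj M := fun x => g x
    have γ_add : ∀ (s : Finset (Fin n)) (x : Fin n → H.obj.obj M),
        γ (∑ j ∈ s, x j) = ∑ j ∈ s, γ (x j) := fun s x => map_sum g.hom x s
    have γ_smul : ∀ (s : M ⟶ M) (x : H.obj.obj M), γ (H.obj.map s x) = F.obj.map s (γ x) :=
      g.hom.map_smul'
    -- The element of `F (Mⁿ)` whose components are the images under `g` of the components of `u`.
    let v : F.obj.obj (⨁ fun _ : Fin n => M) :=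
      ∑ j, F.obj.map (biproduct.ι (fun _ : Fin n => M) j)
        (γ (H.obj.map (biproduct.π (fun _ : Fin n => M) j) u))
    have key : ∀ h : (⨁ fun _ : Fin n => M) ⟶ M, F.obj.map h v = γ (H.obj.map h u) := by
      intro h
      conv_rhs => rw [eq_sum_map_of_biproduct H u]
      rw [map_sum, map_sum, γ_add]
      refine Finset.sum_congr rfl fun j _ => ?_
      rw [← map_comp_apply, ← map_comp_apply, ← γ_smul]
    obtain ⟨α, hα⟩ := hH.exists_hom (G := F.obj) v (ext_of_biproduct F fun k => by
      rw [← map_comp_apply, key, map_comp_apply, hH.map_relation, map_zero, map_zero]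
      exact map_zero g.hom)
    refine ⟨ObjectProperty.homMk α, ?_⟩
    ext x
    obtain ⟨h, rfl⟩ := hH.exists_map_eq (D := M) x
    change α.app M (H.obj.map h u) = γ (H.obj.map h u)
    rw [NatTrans.naturality_apply, hα, key]

/-- The universal property of `Mⁿ`, as an isomorphism `Sⁿ ≅ Hom(Mⁿ, M)` of left modules over
`S = End M`. -/
noncomputable def homPowerEquiv (M : LMod R) (n : ℕ) :
    (Fin n → End M) ≃ₗ[End M] ((⨁ fun _ : Fin n => M) ⟶ M) where
  toFun s := biproduct.desc s
  map_add' s t := biproduct.hom_ext' _ _ fun j => by simp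
  map_smul' r s := biproduct.hom_ext' _ _ fun j => by simp [end_smul_def, End.mul_def]
  invFun g j := biproduct.ι (fun _ : Fin n => M) j ≫ g
  left_inv s := funext fun j => biproduct.ι_desc _ _
  right_inv g := biproduct.hom_ext' _ _ fun j => biproduct.ι_desc _ _

lemma exists_linearEquiv_of_ker_eq {S A B P : Type*} [Ring S] [AddCommGroup A] [Module S A]
    [AddCommGroup B] [Module S B] [AddCommGroup P] [Module S P] (p : P →ₗ[S] A) (q : P →ₗ[S] B)
    (hp : Function.Surjective p) (hq : Function.Surjective q)
    (h : LinearMap.ker p = LinearMap.ker q) : Nonempty (A ≃ₗ[S] B) :=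
  ⟨(p.quotKerEquivOfSurjective hp).symm ≪≫ₗ Submodule.quotEquivOfEq _ _ h ≪≫ₗ
    q.quotKerEquivOfSurjective hq⟩

/-- A presentation `Sᵐ ⟶ Sⁿ ⟶ A ⟶ 0` is a matrix over `S = End M`, hence a map `Mⁿ ⟶ Mᵐ`; the
functor which that map presents has value `A` at `M`. -/
lemma exists_isPresentedBy_evalFunctor_iso (hM : IsFinitelyPresentable.{u} M)
    (A : ModuleCat.{u} (End M)) [Module.FinitePresentation (End M) A] :
    ∃ (H : FreeAb R) (n m : ℕ) (f : (⨁ fun _ : Fin n => M) ⟶ ⨁ fun _ : Fin m => M)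
      (u : H.obj.obj (⨁ fun _ : Fin n => M)),
      IsPresentedBy H.obj f u ∧ Nonempty (A ≅ (evalFunctor M).obj H) := by
  obtain ⟨n, m, p, w, hp, hw⟩ := Module.FinitePresentation.exists_fin' (End M) A
  let f : (⨁ fun _ : Fin n => M) ⟶ ⨁ fun _ : Fin m => M :=
    biproduct.matrix fun j k => w (Pi.single k 1) j
  obtain ⟨H, u, hadd, hH⟩ := exists_isPresentedBy f
  let H' : FreeAb R := ⟨H, isFPFunctor_iff.2 ⟨hadd, _, _, f, u,
    isFinitelyPresentable_biproduct _ fun _ => hM, isFinitelyPresentable_biproduct _ fun _ => hM,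
    hH⟩⟩
  have hf : ∀ s : Fin m → End M, f ≫ homPowerEquiv M m s = homPowerEquiv M n (w s) := by
    intro s
    refine biproduct.hom_ext' _ _ fun j => ?_
    change _ ≫ f ≫ biproduct.desc s = _ ≫ biproduct.desc (w s)
    rw [biproduct.ι_desc, ← Category.assoc, biproduct.ι_matrix, biproduct.lift_desc]
    conv_rhs => rw [pi_eq_sum_univ' s, map_sum]
    rw [Finset.sum_apply]
    refine Finset.sum_congr rfl fun k _ => ?_
    rw [map_smul]
    rfl
  refine ⟨H', n, m, f, u, hH, ?_⟩
  suffices h : Nonempty (A ≃ₗ[End M] (evalFunctor M).obj H') from ⟨h.some.toModuleIso⟩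
  refine exists_linearEquiv_of_ker_eq p (evalElement M H' u ∘ₗ (homPowerEquiv M n).toLinearMap) hp
    ?_ ?_
  · exact Function.Surjective.comp (g := evalElement M H' u) (hH.exists_map_eq (D := M))
      (homPowerEquiv M n).surjective
  · ext s
    rw [LinearMap.mem_ker, hw]
    refine Iff.trans ?_ (hH.map_eq_zero_iff (homPowerEquiv M n s)).symm
    constructor
    · rintro ⟨s, rfl⟩
      exact ⟨_, hf s⟩
    · rintro ⟨y, hy⟩
      refine ⟨(homPowerEquiv M m).symm y, (homPowerEquiv M n).injective ?_⟩
      rw [← hf, LinearEquiv.apply_symm_apply, hy]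

/-- Evaluation at `M`, with values in the finitely presented left `End M`-modules. -/
def fpEvalFunctor (h : ∀ F : FreeAb R, Module.FinitePresentation (End M) ((evalFunctor M).obj F)) :
    FreeAb R ⥤ FPMod (End M) :=
  ObjectProperty.lift _ (evalFunctor M) h

lemma isIso_fpEvalFunctor_map_iff
    (h : ∀ F : FreeAb R, Module.FinitePresentation (End M) ((evalFunctor M).obj F))
    {F G : FreeAb R} (α : F ⟶ G) :
    IsIso ((fpEvalFunctor h).map α) ↔ Function.Bijective (α.hom.app M) := by
  rw [← isIso_iff_of_reflects_iso _ (ObjectProperty.ι _), ConcreteCategory.isIso_iff_bijective]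
  rfl

lemma fpEvalFunctor_isLocalization (hM : IsFinitelyPresentable.{u} M)
    (h : ∀ F : FreeAb R, Module.FinitePresentation (End M) ((evalFunctor M).obj F)) :
    (fpEvalFunctor h).IsLocalization
      ((MorphismProperty.isomorphisms _).inverseImage (fpEvalFunctor h)) := by
  have hex : ∀ A : FPMod (End M), ∃ (H : FreeAb R) (η : A ≅ (fpEvalFunctor h).obj H),
      ∀ F : FreeAb R, Function.Bijective
        (fun α : H ⟶ F => η.hom ≫ (fpEvalFunctor h).map α) := by
    intro A
    have : Module.FinitePresentation (End M) A.obj := A.property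
    obtain ⟨H, n, m, f, u, hH, ⟨e⟩⟩ := exists_isPresentedBy_evalFunctor_iso hM A.obj
    refine ⟨H, ObjectProperty.isoMk _ e, fun F => ?_⟩
    have hb := evalFunctor_map_bijective hH F
    constructor
    · intro α β hαβ
      apply hb.1
      refine congrArg (fun γ : (fpEvalFunctor h).obj H ⟶ (fpEvalFunctor h).obj F => γ.hom)
        ((cancel_epi (ObjectProperty.isoMk (X := A) (Y := (fpEvalFunctor h).obj H) _ e).hom).1 hαβ)
    · intro g
      obtain ⟨α, hα⟩ := hb.2 (e.inv ≫ g.hom)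
      refine ⟨α, ?_⟩
      ext1
      exact e.eq_inv_comp.1 hα
  choose H η hη using hex
  let E : ∀ A F, (H A ⟶ F) ≃ (A ⟶ (fpEvalFunctor h).obj F) := fun A F =>
    Equiv.ofBijective _ (hη A F)
  have hE : ∀ A F F' g k, E A F' (k ≫ g) = E A F k ≫ (fpEvalFunctor h).map g := by
    intro A F F' g k
    change (η A).hom ≫ (fpEvalFunctor h).map (k ≫ g) =
      ((η A).hom ≫ (fpEvalFunctor h).map k) ≫ (fpEvalFunctor h).map g
    rw [Functor.map_comp, Category.assoc]
  let adj := Adjunction.adjunctionOfEquivLeft E hE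
  have hunit : IsIso adj.unit := by
    rw [NatTrans.isIso_iff_isIso_app]
    intro A
    have : adj.unit.app A = (η A).hom := by
      change E A (H A) (𝟙 _) = _
      change (η A).hom ≫ (fpEvalFunctor h).map (𝟙 _) = _
      rw [CategoryTheory.Functor.map_id, Category.comp_id]
    rw [this]
    infer_instance
  have := adj.fullyFaithfulLOfIsIsoUnit.full
  have := adj.fullyFaithfulLOfIsIsoUnit.faithful
  exact adj.isLocalization_rightAdjoint'

end Adjoint

/-! ### The comparison map -/

section Comparison

variable {R : Type u} [SmallCategory R] [Preadditive R] {M : LMod R}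

/-- The natural transformation `F D ⟶ Hom_S(Hom_R(D, M), A)`, `x ↦ (h ↦ g (F h x))`, induced by an
`S`-linear map `g : F M ⟶ A`. -/
def evalToHomHom (F : FreeAb R) {A : ModuleCat.{u} (End M)} (g : (evalFunctor M).obj F ⟶ A) :
    F.obj ⟶ homHom M A where
  app D := AddCommGrpCat.ofHom (AddMonoidHom.mk'
    (fun x : F.obj.obj D => (g.hom ∘ₗ evalElement M F x : (D ⟶ M) →ₗ[End M] A))
    (fun x y => by
      ext h
      change g.hom (F.obj.map h (x + y)) = g.hom (F.obj.map h x) + g.hom (F.obj.map h y)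
      rw [map_add]
      exact map_add g.hom _ _))
  naturality D D' k := by
    ext x
    refine LinearMap.ext fun h => ?_
    change g.hom (F.obj.map h (F.obj.map k x)) = g.hom (F.obj.map (k ≫ h) x)
    rw [map_comp_apply]

/-- If `1_D = ∑ j, a j ≫ b j` with all terms factoring through `M`, then the preimage of `φ` is
`∑ j, F (b j) (φ (a j))`, up to the identification of `A` with `F M`. -/
lemma evalToHomHom_app_bijective (F : FreeAb R) {A : ModuleCat.{u} (End M)}
    (e : (evalFunctor M).obj F ≅ A) {D : LMod R} {J : Type u} [Fintype J]
    (a : J → (D ⟶ M)) (b : J → (M ⟶ D)) (h : 𝟙 D = ∑ j, a j ≫ b j) :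
    Function.Bijective ((evalToHomHom F e.hom).app D) := by
  have hinj : Function.Injective e.hom := e.toLinearEquiv.injective
  have hx : ∀ x : F.obj.obj D, x = ∑ j, F.obj.map (b j) (F.obj.map (a j) x) := fun x => by
    have := congrArg (fun g => F.obj.map g x) h
    simp only [map_sum_apply, map_comp_apply, CategoryTheory.Functor.map_id] at this
    exact this
  constructor
  · intro x y hxy
    have h' : ∀ k : D ⟶ M, F.obj.map k x = F.obj.map k y := fun k =>
      hinj (LinearMap.congr_fun (hxy : (e.hom.hom ∘ₗ evalElement M F x) =
        (e.hom.hom ∘ₗ evalElement M F y)) k)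
    rw [hx x, hx y]
    simp only [h']
  · intro (φ : (D ⟶ M) →ₗ[End M] A)
    let ψ : (D ⟶ M) →ₗ[End M] (evalFunctor M).obj F := e.inv.hom ∘ₗ φ
    refine ⟨∑ j, F.obj.map (b j) (ψ (a j)), ?_⟩
    refine LinearMap.ext fun k : D ⟶ M => ?_
    change e.hom.hom (F.obj.map k (∑ j, F.obj.map (b j) (ψ (a j)))) = φ k
    have : F.obj.map k (∑ j, F.obj.map (b j) (ψ (a j))) = ψ k := by
      rw [map_sum]
      let r : J → End M := fun j => b j ≫ k
      have hk : k = ∑ j, r j • a j := by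
        conv_lhs => rw [← Category.id_comp k, h, Preadditive.sum_comp]
        exact Finset.sum_congr rfl fun j _ => Category.assoc _ _ _
      conv_rhs => rw [hk, map_sum]
      refine Finset.sum_congr rfl fun j _ => ?_
      rw [map_smul]
      exact (map_comp_apply F.obj (b j) k (ψ (a j))).symm
    rw [this]
    exact e.inv_hom_id_apply (φ k)

/-- A functor that vanishes at `M` vanishes at `D` if maps from finitely presented modules to `D` are
finite sums of maps through `M`: every element of `F D` is `F g u` for such a map `g`. -/
lemma eq_zero_of_factorization (F : FreeAb R) (hF : ∀ x : F.obj.obj M, x = 0) {D : LMod R}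
    (hD : ∀ (X : LMod R), IsFinitelyPresentable.{u} X → ∀ g : X ⟶ D,
      ∃ (J : Type u) (_ : Fintype J) (a : J → (X ⟶ M)) (b : J → (M ⟶ D)), g = ∑ j, a j ≫ b j)
    (x : F.obj.obj D) : x = 0 := by
  obtain ⟨X, Y, f, u, hX, hY, h⟩ := F.exists_isPresentedBy
  obtain ⟨g, rfl⟩ := h.exists_map_eq x
  obtain ⟨J, _, a, b, rfl⟩ := hD X hX g
  rw [map_sum_apply]
  refine Finset.sum_eq_zero fun j _ => ?_
  rw [map_comp_apply, hF (F.obj.map (a j) u), map_zero]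

end Comparison

/-! ### The functor category of a definable category of direct sums -/

theorem corollary10p2 {R : Type u} [SmallCategory R] [Preadditive R]
    (𝒟 : ObjectProperty (LMod R)) (hdef : IsDefinableSubcategory 𝒟)
    {t : ℕ} (N : Fin t → LMod R) (hN : ∀ i, IsFinitelyPresentable.{u} (N i))
    (hsum : ∀ D : LMod R, 𝒟 D ↔ IsDirectSumOfCopies N D)
    -- `M := c.pt` is the direct sum of the modules `N i`, and `S := End M`
    (c : Cofan N) (hc : IsColimit c) :
    ∃ e : FunctorCategory 𝒟 ≌ FPMod (End c.pt),
      -- the equivalence is induced by `F ↦ F M`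
      Nonempty (quotientFunctor 𝒟 ⋙ e.functor ⋙ ObjectProperty.ι _ ≅ evalFunctor c.pt) ∧
      -- the functor on `𝒟` corresponding to `A`
      ∀ (A : FPMod (End c.pt)),
        (∃ F : FreeAb R, Nonempty ((quotientFunctor 𝒟).obj F ≅ e.inverse.obj A)) ∧
        ∀ F : FreeAb R, Nonempty ((quotientFunctor 𝒟).obj F ≅ e.inverse.obj A) →
          PreservesFilteredColimitsOfSize.{u, u} F.obj ∧
          ∃ τ : 𝒟.ι ⋙ F.obj ⟶ 𝒟.ι ⋙ homHom c.pt A.obj,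
            ∀ D : 𝒟.FullSubcategory, IsFinitelyPresentable.{u} D.obj → IsIso (τ.app D) := by
  have hM : IsFinitelyPresentable.{u} c.pt :=
    isFinitelyPresentable_of_isColimit hc fun j => hN j.as
  have hM𝒟 : 𝒟 c.pt := (hsum _).2 (isDirectSumOfCopies_coproduct hc)
  have hfact : ∀ D, 𝒟 D → ∀ (X : LMod R), IsFinitelyPresentable.{u} X → ∀ g : X ⟶ D,
      ∃ (J : Type u) (_ : Fintype J) (a : J → (X ⟶ c.pt)) (b : J → (c.pt ⟶ D)),
        g = ∑ j, a j ≫ b j :=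
    fun D hD X hX g => ((hsum D).1 hD).exists_eq_sum hc hX g
  have hfin : ∀ X : LMod R, IsFinitelyPresentable.{u} X →
      Module.Finite (End c.pt) (X ⟶ c.pt) := by
    intro X hX
    have := hdef.products (X ⟶ c.pt)
    -- The canonical map from `X` to this power of `M` factors every map `X ⟶ M`.
    have hP : 𝒟 (∏ᶜ fun _ : X ⟶ c.pt => c.pt) := 𝒟.prop_limit _ fun _ => hM𝒟
    obtain ⟨J, _, a, b, hab⟩ := hfact _ hP X hX (Pi.lift fun h => h)
    exact module_finite_hom (fun h => Pi.π _ h) _ (fun h => Pi.lift_π _ _) a b hab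
  have hfp : ∀ F : FreeAb R, Module.FinitePresentation (End c.pt) ((evalFunctor c.pt).obj F) :=
    fun F => finitePresentation_evalFunctor hfin hM F
  have hW : isoModulo (vanishingOn 𝒟) =
      (MorphismProperty.isomorphisms _).inverseImage (fpEvalFunctor hfp) := by
    ext F G α
    rw [isoModulo_vanishingOn_iff hM𝒟 fun F hF D hD x =>
      eq_zero_of_factorization F hF (hfact D hD) x]
    exact (isIso_fpEvalFunctor_map_iff hfp α).symm
  have hloc : (fpEvalFunctor hfp).IsLocalization (isoModulo (vanishingOn 𝒟)) := by
    rw [hW]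
    exact fpEvalFunctor_isLocalization hM hfp
  let e : FunctorCategory 𝒟 ≌ FPMod (End c.pt) :=
    Localization.equivalenceFromModel (fpEvalFunctor hfp) (isoModulo (vanishingOn 𝒟))
  let ie : quotientFunctor 𝒟 ⋙ e.functor ≅ fpEvalFunctor hfp :=
    Localization.qCompEquivalenceFromModelFunctorIso (fpEvalFunctor hfp) (isoModulo (vanishingOn 𝒟))
  refine ⟨e, ⟨(Functor.associator _ _ _).symm ≪≫ Functor.isoWhiskerRight ie _⟩, fun A => ⟨?_, ?_⟩⟩
  · have := Localization.essSurj (quotientFunctor 𝒟) (isoModulo (vanishingOn 𝒟))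
    exact ⟨_, ⟨(quotientFunctor 𝒟).objObjPreimageIso (e.inverse.obj A)⟩⟩
  · rintro F ⟨i⟩
    let k : (evalFunctor c.pt).obj F ≅ A.obj := (ObjectProperty.ι _).mapIso
      ((ie.app F).symm ≪≫ e.functor.mapIso i ≪≫ e.counitIso.app A)
    refine ⟨?_, Functor.whiskerLeft 𝒟.ι (evalToHomHom F k.hom), fun D hD => ?_⟩
    · obtain ⟨X, Y, f, u, hX, hY, h⟩ := F.exists_isPresentedBy
      exact h.preservesFilteredColimitsOfSize
    · obtain ⟨J, _, a, b, h⟩ := hfact _ D.property D.obj hD (𝟙 _)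
      rw [ConcreteCategory.isIso_iff_bijective]
      exact evalToHomHom_app_bijective F k a b h
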